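/- Let $n \ge 0$ and let $f:\{0,1\}^n\to\{0,1\}$ be a Boolean function that is not of the form $f(x)=x_i$ or $f(x)=1-x_i$ for any $i$. Let $d(f)$ be the degree of $f$, that is, the total degree of the unique multilinear real polynomial in $n$ variables that agrees with $f$ on $\{0,1\}^n$, and let $D(f)$ be its deterministic decision-tree complexity, that is, the least depth (worst-case number of queried input bits) of a deterministic decision tree that queries single bits of the input $x$ and outputs $f(x)$ for every $x\in\{0,1\}^n$. Then \[ d(f)^3 \ \ge\ (\sqrt{10}-2)\, D(f). \] -/

import Mathlib

/-- The real number `0` or `1` corresponding to a bit. -/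
def bitVal (b : Bool) : ℝ := if b then 1 else 0

/-- `p` is the multilinear real polynomial representing the Boolean function `f`:
it has degree at most one in every variable and agrees with `f` on `{0,1}^n`. -/
def Represents {n : ℕ} (p : MvPolynomial (Fin n) ℝ) (f : (Fin n → Bool) → Bool) : Prop :=
  (∀ i, p.degreeOf i ≤ 1) ∧
    ∀ x : Fin n → Bool, MvPolynomial.eval (fun i => bitVal (x i)) p = bitVal (f x)

/-- The representing polynomial, by interpolation:
`∑_a f(a) ∏_i (x_i if a_i = 1, and 1 - x_i if a_i = 0)`. -/
noncomputable def reprPoly {n : ℕ} (f : (Fin n → Bool) → Bool) : MvPolynomial (Fin n) ℝ :=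
  ∑ a : Fin n → Bool, MvPolynomial.C (bitVal (f a)) *
    ∏ i : Fin n, (if a i then MvPolynomial.X i else 1 - MvPolynomial.X i)

/-- The degree `d(f)` of a Boolean function: the total degree of the unique multilinear real
polynomial representing it (see `reprPoly_represents` and `Represents.eq_reprPoly`). -/
noncomputable def boolDegree {n : ℕ} (f : (Fin n → Bool) → Bool) : ℕ :=
  (reprPoly f).totalDegree

theorem reprPoly_represents {n : ℕ} (f : (Fin n → Bool) → Bool) : Represents (reprPoly f) f := by
  classical
  constructor
  · intro j
    unfold reprPoly
    refine (MvPolynomial.degreeOf_sum_le j _ _).trans (Finset.sup_le fun a _ => ?_)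
    refine (MvPolynomial.degreeOf_C_mul_le _ j _).trans ?_
    refine (MvPolynomial.degreeOf_prod_le j _ _).trans ?_
    refine (Finset.sum_le_sum (g := fun i => if j = i then 1 else 0) fun i _ => ?_).trans ?_
    · have hX : (MvPolynomial.X i : MvPolynomial (Fin n) ℝ).degreeOf j
          = if j = i then 1 else 0 := MvPolynomial.degreeOf_X j i
      split_ifs with h1 h2 h2
      · simp [hX, h2]
      · simp [hX, h2]
      · refine (MvPolynomial.degreeOf_sub_le j _ _).trans ?_
        simp [hX, h2, MvPolynomial.degreeOf_one]
      · refine (MvPolynomial.degreeOf_sub_le j _ _).trans ?_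
        simp [hX, h2, MvPolynomial.degreeOf_one]
    · simp
  · intro x
    unfold reprPoly
    rw [map_sum, Finset.sum_eq_single x]
    · rw [map_mul, MvPolynomial.eval_C, map_prod, Finset.prod_eq_one, mul_one]
      intro i _
      cases h : x i <;> simp [bitVal, h]
    · intro a _ hax
      obtain ⟨i, hi⟩ := Function.ne_iff.mp hax
      rw [map_mul, map_prod, Finset.prod_eq_zero (Finset.mem_univ i), mul_zero]
      cases h : a i <;> cases h' : x i <;> simp_all [bitVal]
    · simp

theorem Represents.eq_reprPoly {n : ℕ} {f : (Fin n → Bool) → Bool}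
    {p : MvPolynomial (Fin n) ℝ} (hp : Represents p f) : p = reprPoly f := by
  classical
  have hq := reprPoly_represents f
  rw [← sub_eq_zero]
  refine MvPolynomial.eq_zero_of_eval_zero_at_prod_finset _ (fun _ => ({0, 1} : Finset ℝ)) ?_ ?_
  · intro i
    rw [Finset.card_pair zero_ne_one]
    exact lt_of_le_of_lt (MvPolynomial.degreeOf_sub_le i _ _)
      (lt_of_le_of_lt (max_le (hp.1 i) (hq.1 i)) one_lt_two)
  · intro x hx
    have hx' : x = fun i => bitVal (decide (x i = 1)) := by
      funext i
      have := hx i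
      simp only [Finset.mem_insert, Finset.mem_singleton] at this
      rcases this with h | h <;> simp [bitVal, h]
    rw [hx', map_sub, hp.2, hq.2, sub_self]

/-- Deterministic decision trees on `n` input bits: a leaf outputs a bit, an inner node
queries the bit `x_i` and continues in its first subtree if `x_i = 0`, in its second one if
`x_i = 1`. -/
inductive DecisionTree (n : ℕ) : Type
  | leaf (b : Bool) : DecisionTree n
  | query (i : Fin n) (t₀ t₁ : DecisionTree n) : DecisionTree n

/-- The output of a decision tree on an input. -/
def DecisionTree.eval {n : ℕ} : DecisionTree n → (Fin n → Bool) → Bool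
  | .leaf b, _ => b
  | .query i t₀ t₁, x => if x i then t₁.eval x else t₀.eval x

/-- The depth of a decision tree: the largest number of queries on a path from the root. -/
def DecisionTree.depth {n : ℕ} : DecisionTree n → ℕ
  | .leaf _ => 0
  | .query _ t₀ t₁ => max t₀.depth t₁.depth + 1

/-- The tree outputs `f x` on every input `x`. -/
def DecisionTree.Computes {n : ℕ} (t : DecisionTree n) (f : (Fin n → Bool) → Bool) : Prop :=
  ∀ x, t.eval x = f x

/-- The decision tree complexity `D(f)`: the least depth of a decision tree computing `f`
(one exists by `exists_decisionTree`). -/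
noncomputable def decisionTreeComplexity {n : ℕ} (f : (Fin n → Bool) → Bool) : ℕ :=
  sInf {k | ∃ t : DecisionTree n, t.Computes f ∧ t.depth = k}

theorem exists_decisionTree {n : ℕ} (f : (Fin n → Bool) → Bool) :
    ∃ t : DecisionTree n, t.Computes f := by
  classical
  suffices H : ∀ (s : Finset (Fin n)) (g : (Fin n → Bool) → Bool),
      (∀ x y, (∀ i ∈ s, x i = y i) → g x = g y) → ∃ t : DecisionTree n, t.Computes g from
    H Finset.univ f fun x y h => congrArg f (funext fun i => h i (Finset.mem_univ i))
  intro s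
  induction s using Finset.induction_on with
  | empty =>
    intro g hg
    exact ⟨.leaf (g fun _ => false), fun x => hg _ _ (by simp)⟩
  | insert a s _ ih =>
    intro g hg
    have key : ∀ b : Bool, ∃ t : DecisionTree n,
        t.Computes (fun x => g (Function.update x a b)) := by
      intro b
      refine ih _ fun x y h => hg _ _ fun i hi => ?_
      by_cases hia : i = a
      · subst hia; simp
      · rw [Function.update_of_ne hia, Function.update_of_ne hia]
        exact h i ((Finset.mem_insert.mp hi).resolve_left hia)
    obtain ⟨t₀, h₀⟩ := key false
    obtain ⟨t₁, h₁⟩ := key true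
    refine ⟨.query a t₀ t₁, fun x => ?_⟩
    cases hx : x a
    · have : Function.update x a false = x := by rw [← hx, Function.update_eq_self]
      simp [DecisionTree.eval, hx, h₀ x, this]
    · have : Function.update x a true = x := by rw [← hx, Function.update_eq_self]
      simp [DecisionTree.eval, hx, h₁ x, this]

/-! Two bounds combine, with d the degree of f. First, N disjoint sensitive blocks satisfy N(N-1) ≤
(2/3) d²(d²-1). One variable per block gives g with g(0) = 0 and g = 1 at all unit vectors; the
multilinear extension of g, restricted to the diagonal, is a polynomial of degree ≤ d mapping [0,1]
to [0,1], with t²-coefficient at most -N(N-1)/2. Markov's inequality for second derivatives bounds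
that coefficient below (`SensitiveBlocks.mul_sub_one_le`). Second, if no input has more than k
disjoint sensitive blocks, then D(f) ≤ d·k (`hasDepthLE_of_sensitiveBlocks_le`): querying the at
most d variables of a maximal-degree monomial lowers the block bound by one. For d ≥ 2 the first
bound gives (√10-2) N ≤ d². For d ≤ 1 it gives N ≤ 1, so f is constant or one of the excluded
functions. -/

/-! ### Markov's inequality for the second derivative at an endpoint -/

open Polynomial in
theorem neg_coeff_two_le_of_forall_mem_Icc {p : ℝ[X]} {d : ℕ} (hd : p.natDegree ≤ d)
    (hp : ∀ t ∈ Set.Icc (0 : ℝ) 1, p.eval t ∈ Set.Icc (0 : ℝ) 1) :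
    -p.coeff 2 ≤ (d : ℝ) ^ 2 * ((d : ℝ) ^ 2 - 1) / 3 := by
  -- `L` maps [-1,1] onto [0,1] with 1 ↦ 0, so `Q = 1 - 2 p(L)` is bounded by 1 there and Q''(1) =
  -- -p''(0)/2; the Chebyshev polynomial is extremal for this value.
  set L : ℝ[X] := C (1 / 2) * (1 - X) with hL
  have hLd : L.natDegree ≤ 1 := by rw [hL]; compute_degree
  have hderL : derivative L = C (-(1 / 2)) := by simp [hL]
  set Q : ℝ[X] := 1 - 2 * p.comp L with hQ
  have hQd : Q.degree ≤ d := by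
    refine natDegree_le_iff_degree_le.mp ((natDegree_sub_le _ _).trans (max_le (by simp) ?_))
    refine natDegree_mul_le.trans ?_
    have h2 : (2 : ℝ[X]).natDegree = 0 := natDegree_ofNat 2
    rw [h2, zero_add]
    exact natDegree_comp_le.trans ((Nat.mul_le_mul hd hLd).trans (by simp))
  have hQb : ∀ x ∈ Set.Icc (-1 : ℝ) 1, |Q.eval x| ≤ 1 := by
    intro x hx
    obtain ⟨h0, h1⟩ := hp (1 / 2 * (1 - x)) ⟨by linarith [hx.2], by linarith [hx.1]⟩
    have : Q.eval x = 1 - 2 * p.eval (1 / 2 * (1 - x)) := by simp [hQ, hL, eval_comp]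
    rw [this, abs_le]
    constructor <;> linarith
  have key := Chebyshev.eval_iterate_derivative_le_of_forall_abs_le_one (k := 2) le_rfl hQd hQb
  have hT : (derivative^[2] (Chebyshev.T ℝ (d : ℤ))).eval 1
      = (d : ℝ) ^ 2 * ((d : ℝ) ^ 2 - 1) / 3 := by
    rw [Chebyshev.iterate_derivative_T_eval_one_eq_div]
    simp [Finset.prod_range_succ]
  have hQ2 : (derivative^[2] Q).eval 1 = -p.coeff 2 := by
    have h2 : (derivative^[2] p).eval 0 = 2 * p.coeff 2 := by
      rw [← coeff_zero_eq_eval_zero, coeff_iterate_derivative]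
      simp [Nat.descFactorial]
    have : L.eval 1 = 0 := by simp [hL]
    simp only [Function.iterate_succ, Function.iterate_zero, Function.comp_def, id] at h2 ⊢
    simp [hQ, derivative_comp, hderL, eval_comp, this, h2]
  rw [hQ2, hT] at key
  exact key


/-! ### Degree under substitution and negation -/

-- Since b^k = b for bits and k ≥ 1, truncating all exponents at 1 keeps the values on the cube and
-- does not raise the degree.
open MvPolynomial in
theorem boolDegree_le_totalDegree {n : ℕ} {f : (Fin n → Bool) → Bool}
    (q : MvPolynomial (Fin n) ℝ)
    (hq : ∀ x : Fin n → Bool, eval (fun i => bitVal (x i)) q = bitVal (f x)) :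
    boolDegree f ≤ q.totalDegree := by
  classical
  let red : (Fin n →₀ ℕ) → (Fin n →₀ ℕ) := fun s => s.mapRange (min 1) (by simp)
  let r : MvPolynomial (Fin n) ℝ := ∑ s ∈ q.support, monomial (red s) (q.coeff s)
  have hr : Represents r f := by
    constructor
    · intro i
      refine (degreeOf_sum_le i _ _).trans (Finset.sup_le fun s _ => ?_)
      by_cases h : q.coeff s = 0
      · simp [h]
      · rw [degreeOf_monomial_eq _ _ h]
        simp [red]
    · intro x
      rw [← hq x]
      conv_rhs => rw [q.as_sum]
      simp only [r, map_sum, eval_monomial]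
      refine Finset.sum_congr rfl fun s _ => ?_
      congr 1
      rw [Finsupp.prod_fintype _ _ (by simp), Finsupp.prod_fintype _ _ (by simp)]
      refine Finset.prod_congr rfl fun i _ => ?_
      have : red s i = min 1 (s i) := rfl
      rw [this]
      rcases Nat.eq_zero_or_pos (s i) with h | h
      · simp [h]
      · rw [min_eq_left h]
        cases x i <;> simp [bitVal, h.ne']
  unfold boolDegree
  rw [← hr.eq_reprPoly]
  refine totalDegree_finsetSum_le fun s hs => ?_
  refine (totalDegree_monomial_le _ _).trans ((?_ : _ ≤ s.degree).trans (le_totalDegree hs))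
  rw [Finsupp.sum_fintype _ _ (by simp), Finsupp.degree_eq_sum]
  exact Finset.sum_le_sum fun i _ => min_le_right _ _


open MvPolynomial in
theorem boolDegree_comp_le {m n : ℕ} (f : (Fin n → Bool) → Bool)
    (y : (Fin m → Bool) → Fin n → Bool)
    (hy : ∀ j, (∃ b, ∀ z, y z j = b) ∨ ∃ i b, ∀ z, y z j = xor b (z i)) :
    boolDegree (fun z => f (y z)) ≤ boolDegree f := by
  have hσ : ∀ j, ∃ p : MvPolynomial (Fin m) ℝ, p.totalDegree ≤ 1 ∧
      ∀ z : Fin m → Bool, eval (fun i => bitVal (z i)) p = bitVal (y z j) := by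
    intro j
    obtain ⟨b, h⟩ | ⟨i, b, h⟩ := hy j
    · exact ⟨C (bitVal b), by simp, fun z => by simp [h]⟩
    · cases b
      · exact ⟨X i, by simp, fun z => by simp [h]⟩
      · refine ⟨1 - X i, (totalDegree_sub _ _).trans (by simp), fun z => ?_⟩
        rw [h]
        cases hz : z i <;> simp [bitVal, hz]
  choose σ hσd hσe using hσ
  refine (boolDegree_le_totalDegree (aeval σ (reprPoly f)) fun z => ?_).trans ?_
  · rw [← (reprPoly_represents f).2]
    have : (eval fun i => bitVal (z i)) (aeval σ (reprPoly f))
        = eval (fun j => (eval fun i => bitVal (z i)) (σ j)) (reprPoly f) := by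
      rw [aeval_def, eval₂_eq, map_sum, eval_eq]
      simp
    rw [this]
    simp [hσe]
  · rw [aeval_def, eval₂_eq]
    refine totalDegree_finsetSum_le fun s hs => ?_
    refine (totalDegree_mul _ _).trans ?_
    rw [algebraMap_eq, totalDegree_C, zero_add]
    refine (totalDegree_finsetProd _ _).trans (le_trans ?_ (le_totalDegree hs))
    refine Finset.sum_le_sum fun j _ => (totalDegree_pow _ _).trans ?_
    exact (Nat.mul_le_mul_left _ (hσd j)).trans (by simp)


open MvPolynomial in
theorem boolDegree_xor_le {n : ℕ} (f : (Fin n → Bool) → Bool) (b : Bool) :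
    boolDegree (fun x => xor (f x) b) ≤ boolDegree f := by
  cases b
  · simp
  · refine (boolDegree_le_totalDegree (1 - reprPoly f) fun x => ?_).trans
      ((totalDegree_sub _ _).trans (by simp [boolDegree]))
    rw [map_sub, (reprPoly_represents f).2]
    cases f x <;> simp [bitVal]

/-! ### Monomials of maximal degree -/

theorem bitVal_injective : Function.Injective bitVal := by
  intro a b h
  cases a <;> cases b <;> simp_all [bitVal]

/-- Every `x` is sensitive to a change inside the variables of a monomial of maximal degree. -/
theorem exists_finset_sensitive {n : ℕ} (f : (Fin n → Bool) → Bool) (hf : ∃ x y, f x ≠ f y) :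
    ∃ M : Finset (Fin n), M.card ≤ boolDegree f ∧
      ∀ x, ∃ y, (∀ j, j ∉ M → y j = x j) ∧ f y ≠ f x := by
  classical
  set P := reprPoly f with hP
  have hrep := reprPoly_represents f
  have hP0 : P.support.Nonempty := by
    rw [Finset.nonempty_iff_ne_empty, Ne, MvPolynomial.support_eq_empty]
    intro h0
    obtain ⟨x, y, hxy⟩ := hf
    have hx := hrep.2 x
    have hy := hrep.2 y
    rw [← hP, h0, map_zero] at hx hy
    exact hxy (bitVal_injective (hx.symm.trans hy))
  obtain ⟨s, hs, hsd⟩ := Finset.exists_mem_eq_sup P.support hP0 Finsupp.degree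
  have hsdeg : ∀ u ∈ P.support, u.degree ≤ s.degree := fun u hu =>
    hsd ▸ Finset.le_sup (f := Finsupp.degree) hu
  have hs1 : ∀ i, s i ≤ 1 := fun i =>
    ((MvPolynomial.degreeOf_le_iff.mp (hrep.1 i)) s hs)
  have hsM : ∀ i ∈ s.support, s i = 1 := fun i hi =>
    le_antisymm (hs1 i) (Nat.one_le_iff_ne_zero.mpr (Finsupp.mem_support_iff.mp hi))
  have hcard : s.degree = s.support.card := by
    rw [Finsupp.degree, Finset.card_eq_sum_ones]
    exact Finset.sum_congr rfl hsM
  have hM0 : s.support.Nonempty := by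
    rw [Finset.nonempty_iff_ne_empty, Ne, ← Finset.card_eq_zero, ← hcard]
    intro h0
    have hC : P.totalDegree = 0 := by
      refine Nat.le_zero.mp (Finset.sup_le fun u hu => ?_)
      exact (hsdeg u hu).trans h0.le
    obtain ⟨x, y, hxy⟩ := hf
    have hx := hrep.2 x
    have hy := hrep.2 y
    rw [← hP, MvPolynomial.totalDegree_eq_zero_iff_eq_C.mp hC, MvPolynomial.eval_C] at hx hy
    exact hxy (bitVal_injective (hx.symm.trans hy))
  refine ⟨s.support, ?_, fun x => ?_⟩
  · rw [← hcard]
    exact MvPolynomial.le_totalDegree hs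
  by_contra! hcon
  set M := s.support with hM
  let pt : Finset (Fin n) → Fin n → Bool := fun T j => if j ∈ M then decide (j ∈ T) else x j
  have hpt : ∀ T, f (pt T) = f x := fun T => hcon _ fun j hj => by simp [pt, hj]
  -- The alternating sum over the subcube through `x` in the directions `M` kills constants.
  -- Computed from `P`, it keeps only monomials containing all of `M`; by maximality of the degree
  -- that is `s` alone, with nonzero coefficient.
  have hsum0 : ∑ T ∈ M.powerset, (-1 : ℝ) ^ T.card * bitVal (f (pt T)) = 0 := by
    simp only [hpt, ← Finset.sum_mul]
    have := Finset.sum_powerset_neg_one_pow_card_of_nonempty hM0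
    have h' : ∑ T ∈ M.powerset, (-1 : ℝ) ^ T.card = 0 := by exact_mod_cast this
    rw [h', zero_mul]
  have hmon : ∀ u : Fin n →₀ ℕ, ∑ T ∈ M.powerset, (-1 : ℝ) ^ T.card *
      ∏ j, bitVal (pt T j) ^ u j
      = (∏ j ∈ M, (-1 + (0 : ℝ) ^ u j)) * ∏ j ∈ Mᶜ, bitVal (x j) ^ u j := by
    intro u
    rw [Finset.prod_add, Finset.sum_mul]
    refine Finset.sum_congr rfl fun T hT => ?_
    have hTM := Finset.mem_powerset.mp hT
    rw [Finset.prod_const, ← Finset.prod_mul_prod_compl M, mul_assoc]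
    congr 1
    rw [← Finset.prod_sdiff hTM]
    have h1 : ∏ j ∈ T, bitVal (pt T j) ^ u j = 1 := Finset.prod_eq_one fun j hj => by
      simp [pt, hTM hj, hj, bitVal]
    rw [h1, mul_one]
    congr 1
    · refine Finset.prod_congr rfl fun j hj => ?_
      rw [Finset.mem_sdiff] at hj
      simp [pt, hj.1, hj.2, bitVal]
    · refine Finset.prod_congr rfl fun j hj => ?_
      simp [pt, Finset.mem_compl.mp hj]
  have hexp : ∑ T ∈ M.powerset, (-1 : ℝ) ^ T.card * bitVal (f (pt T))
      = ∑ u ∈ P.support, P.coeff u *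
        ((∏ j ∈ M, (-1 + (0 : ℝ) ^ u j)) * ∏ j ∈ Mᶜ, bitVal (x j) ^ u j) := by
    simp only [← hrep.2, ← hP, MvPolynomial.eval_eq', Finset.mul_sum, ← hmon]
    rw [Finset.sum_comm]
    exact Finset.sum_congr rfl fun u _ => Finset.sum_congr rfl fun T _ => by ring
  rw [hexp, Finset.sum_eq_single s] at hsum0
  · have h1 : ∏ j ∈ M, (-1 + (0 : ℝ) ^ s j) ≠ 0 :=
      Finset.prod_ne_zero_iff.mpr fun j hj => by simp [hsM j hj]
    have h2 : ∏ j ∈ Mᶜ, bitVal (x j) ^ s j = 1 := Finset.prod_eq_one fun j hj => by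
      rw [Finset.mem_compl, hM, Finsupp.notMem_support_iff] at hj
      simp [hj]
    rw [h2, mul_one] at hsum0
    exact (mul_ne_zero (MvPolynomial.mem_support_iff.mp hs) h1) hsum0
  · intro u hu hus
    by_cases hz : ∃ j ∈ M, u j = 0
    · obtain ⟨j, hj, huj⟩ := hz
      rw [Finset.prod_eq_zero hj (by simp [huj])]
      simp
    · push Not at hz
      have hle : ∀ j, s j ≤ u j := fun j => by
        by_cases hj : j ∈ M
        · exact (hs1 j).trans (Nat.one_le_iff_ne_zero.mpr (hz j hj))
        · rw [hM, Finsupp.notMem_support_iff] at hj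
          simp [hj]
      refine absurd ?_ hus
      have hd := hsdeg u hu
      rw [Finsupp.degree_eq_sum, Finsupp.degree_eq_sum] at hd
      have heq := (Finset.sum_eq_sum_iff_of_le fun j _ => hle j).mp
        (le_antisymm (Finset.sum_le_sum fun j _ => hle j) hd)
      ext j
      exact (heq j (Finset.mem_univ j)).symm
  · intro h
    exact absurd hs h

/-! ### Bounding the number of disjoint sensitive blocks -/

/-- `x` with the bits in `B` flipped. -/
def flipOn {n : ℕ} (x : Fin n → Bool) (B : Finset (Fin n)) : Fin n → Bool :=
  fun j => xor (x j) (decide (j ∈ B))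

/-- The sets `B i` are disjoint sensitive blocks of `f` at `x`. -/
def SensitiveBlocks {n N : ℕ} (f : (Fin n → Bool) → Bool) (x : Fin n → Bool)
    (B : Fin N → Finset (Fin n)) : Prop :=
  Pairwise (fun i j => Disjoint (B i) (B j)) ∧ ∀ i, f (flipOn x (B i)) ≠ f x

/-- The univariate restriction of the multilinear extension of `g` to the main diagonal. -/
noncomputable def diagPoly {N : ℕ} (g : (Fin N → Bool) → Bool) : Polynomial ℝ :=
  ∑ a : Fin N → Bool, Polynomial.C (bitVal (g a)) *
    ∏ i : Fin N, (if a i then Polynomial.X else 1 - Polynomial.X)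


open Polynomial in
theorem natDegree_diagPoly_le {N : ℕ} (g : (Fin N → Bool) → Bool) :
    (diagPoly g).natDegree ≤ boolDegree g := by
  have h : diagPoly g = MvPolynomial.aeval (fun _ => (X : ℝ[X])) (reprPoly g) := by
    simp [diagPoly, reprPoly, apply_ite, map_sum, map_prod]
  rw [h]
  refine (MvPolynomial.aeval_natDegree_le (m := boolDegree g) (n := 1) _ le_rfl _ ?_).trans ?_
  · simp
  · simp

theorem bitVal_mem_Icc (b : Bool) : bitVal b ∈ Set.Icc (0 : ℝ) 1 := by
  cases b <;> simp [bitVal]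

theorem sum_prod_ite_eq_one {R : Type*} [CommRing R] (N : ℕ) (t : R) :
    ∑ a : Fin N → Bool, ∏ i : Fin N, (if a i then t else 1 - t) = 1 := by
  have := Finset.prod_univ_sum (fun _ : Fin N => (Finset.univ : Finset Bool))
    (fun _ b => if b then t else 1 - t)
  rw [Fintype.piFinset_univ] at this
  rw [← this]
  simp


open Polynomial in
theorem eval_diagPoly_mem_Icc {N : ℕ} (g : (Fin N → Bool) → Bool) {t : ℝ}
    (ht : t ∈ Set.Icc (0 : ℝ) 1) : (diagPoly g).eval t ∈ Set.Icc (0 : ℝ) 1 := by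
  have he : (diagPoly g).eval t =
      ∑ a : Fin N → Bool, bitVal (g a) * ∏ i : Fin N, (if a i then t else 1 - t) := by
    simp [diagPoly, eval_finsetSum, eval_prod, apply_ite]
  -- The value at `t` is the mean of `g` over independent bits that are 1 with probability `t`.
  have h0 : ∀ a : Fin N → Bool, 0 ≤ ∏ i : Fin N, (if a i then t else 1 - t) := fun a =>
    Finset.prod_nonneg fun i _ => by split_ifs <;> linarith [ht.1, ht.2]
  rw [he]
  constructor
  · exact Finset.sum_nonneg fun a _ => mul_nonneg (bitVal_mem_Icc _).1 (h0 a)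
  · exact (Finset.sum_le_sum fun a _ =>
      mul_le_of_le_one_left (h0 a) (bitVal_mem_Icc _).2).trans_eq (sum_prod_ite_eq_one N t)


open Polynomial in
theorem coeff_two_prod_nonneg {N : ℕ} {a : Fin N → Bool} {i j : Fin N} (hij : i ≠ j)
    (hi : a i = true) (hj : a j = true) :
    0 ≤ (∏ i : Fin N, (if a i then (X : ℝ[X]) else 1 - X)).coeff 2 := by
  classical
  rw [← Finset.mul_prod_erase _ _ (Finset.mem_univ i),
    ← Finset.mul_prod_erase _ _ (Finset.mem_erase.mpr ⟨hij.symm, Finset.mem_univ j⟩), hi, hj]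
  simp only [if_true, coeff_X_mul]
  rw [coeff_zero_eq_eval_zero, eval_prod]
  exact Finset.prod_nonneg fun k _ => by split_ifs <;> simp


open Polynomial in
theorem coeff_two_one_sub_X_pow (N : ℕ) :
    ((1 - X : ℝ[X]) ^ N).coeff 2 = (N : ℝ) * (N - 1) / 2 := by
  rw [← Nat.cast_choose_two]
  have : (1 - X : ℝ[X]) ^ N = ((1 + X : ℝ[X]) ^ N).comp (C (-1) * X) := by simp [sub_eq_add_neg]
  rw [this, comp_C_mul_X_coeff, coeff_one_add_X_pow]
  simp


-- The t²-coefficients of the weights of all points sum to 0. The origin contributes N(N-1)/2 to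
-- that sum but has g = 0; unit vectors count fully; the other points have nonnegative coefficients,
-- so g ≤ 1 can only lower the total.
open Polynomial in
theorem coeff_two_diagPoly_le {N : ℕ} (g : (Fin N → Bool) → Bool)
    (h0 : g (fun _ => false) = false) (h1 : ∀ i, g (fun j => decide (j = i)) = true) :
    (diagPoly g).coeff 2 ≤ -((N : ℝ) * (N - 1) / 2) := by
  classical
  set c : (Fin N → Bool) → ℝ[X] := fun a => ∏ i : Fin N, (if a i then X else 1 - X) with hc
  have hsum : ∑ a, (c a).coeff 2 = 0 := by
    rw [← finsetSum_coeff, hc, sum_prod_ite_eq_one, coeff_one]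
    simp
  have hc0 : (c fun _ => false).coeff 2 = (N : ℝ) * (N - 1) / 2 := by
    simp only [hc, Bool.false_eq_true, if_false, Finset.prod_const, Finset.card_univ,
      Fintype.card_fin]
    exact coeff_two_one_sub_X_pow N
  have hle : ∀ a, bitVal (g a) * (c a).coeff 2 ≤
      (c a).coeff 2 - if a = (fun _ => false) then (N : ℝ) * (N - 1) / 2 else 0 := by
    intro a
    split_ifs with ha
    · rw [ha, h0, hc0]
      simp [bitVal]
    rw [sub_zero]
    obtain ⟨i, hi⟩ := Function.ne_iff.mp ha
    replace hi : a i = true := by simpa using hi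
    by_cases hj : ∃ j, i ≠ j ∧ a j = true
    · obtain ⟨j, hij, hj⟩ := hj
      exact mul_le_of_le_one_left (coeff_two_prod_nonneg hij hi hj) (bitVal_mem_Icc _).2
    · have hai : a = fun j => decide (j = i) := by
        funext j
        by_cases hji : j = i
        · simp [hji, hi]
        · have : a j ≠ true := fun h => hj ⟨j, Ne.symm hji, h⟩
          simpa [hji] using this
      rw [hai, h1]
      simp [bitVal]
  calc (diagPoly g).coeff 2 = ∑ a, bitVal (g a) * (c a).coeff 2 := by
        simp [diagPoly, finsetSum_coeff, hc]
    _ ≤ _ := Finset.sum_le_sum fun a _ => hle a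
    _ = _ := by rw [Finset.sum_sub_distrib, hsum]; simp

theorem SensitiveBlocks.mul_sub_one_le {n N : ℕ} {f : (Fin n → Bool) → Bool}
    {x : Fin n → Bool} {B : Fin N → Finset (Fin n)} (hB : SensitiveBlocks f x B) :
    (N : ℝ) * (N - 1) ≤ 2 / 3 * ((boolDegree f : ℝ) ^ 2 * ((boolDegree f : ℝ) ^ 2 - 1)) := by
  classical
  let y : (Fin N → Bool) → Fin n → Bool := fun z => flipOn x {j | ∃ i, j ∈ B i ∧ z i = true}
  let g : (Fin N → Bool) → Bool := fun z => xor (f (y z)) (f x)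
  have hg : boolDegree g ≤ boolDegree f := by
    refine (boolDegree_xor_le (fun z => f (y z)) (f x)).trans (boolDegree_comp_le f y fun j => ?_)
    -- By disjointness each coordinate of `y z` depends on at most one `z i`, so the substitution
    -- does not raise the degree.
    by_cases hj : ∃ i, j ∈ B i
    · obtain ⟨i, hi⟩ := hj
      refine Or.inr ⟨i, x j, fun z => ?_⟩
      have : (∃ i, j ∈ B i ∧ z i = true) ↔ z i = true := by
        refine ⟨fun ⟨k, hk, hz⟩ => ?_, fun h => ⟨i, hi, h⟩⟩
        by_cases hki : k = i
        · exact hki ▸ hz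
        · exact absurd hi (Finset.disjoint_left.mp (hB.1 hki) hk)
      simp [y, flipOn, this]
    · refine Or.inl ⟨x j, fun z => ?_⟩
      push Not at hj
      simp [y, flipOn, hj]
  have h0 : g (fun _ => false) = false := by
    have : y (fun _ => false) = x := by funext j; simp [y, flipOn]
    simp [g, this]
  have h1 : ∀ i, g (fun j => decide (j = i)) = true := by
    intro i
    have : y (fun j => decide (j = i)) = flipOn x (B i) := by
      funext j; simp [y, flipOn]
    simpa [g, this] using hB.2 i
  have hcoeff := coeff_two_diagPoly_le g h0 h1
  have hmarkov := neg_coeff_two_le_of_forall_mem_Icc ((natDegree_diagPoly_le g).trans hg)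
    fun t ht => eval_diagPoly_mem_Icc g ht
  linarith

/-! ### Decision trees from block bounds -/

/-- `f` is computed by a decision tree of depth at most `k`. -/
def HasDepthLE {n : ℕ} (f : (Fin n → Bool) → Bool) (k : ℕ) : Prop :=
  ∃ t : DecisionTree n, t.Computes f ∧ t.depth ≤ k

theorem HasDepthLE.complexity_le {n k : ℕ} {f : (Fin n → Bool) → Bool} (h : HasDepthLE f k) :
    decisionTreeComplexity f ≤ k := by
  obtain ⟨t, ht, hk⟩ := h
  have h : decisionTreeComplexity f ≤ t.depth := Nat.sInf_le ⟨t, ht, rfl⟩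
  exact h.trans hk

theorem hasDepthLE_of_restrict {n m : ℕ} (M : Finset (Fin n)) :
    ∀ f : (Fin n → Bool) → Bool,
      (∀ a : Fin n → Bool, HasDepthLE (fun y => f (M.piecewise a y)) m) →
      HasDepthLE f (M.card + m) := by
  classical
  induction M using Finset.induction_on with
  | empty =>
    intro f h
    simpa using h fun _ => false
  | insert i M hi ih =>
    intro f h
    have key : ∀ b, HasDepthLE (fun y => f (Function.update y i b)) (M.card + m) := by
      intro b
      refine ih _ fun a => ?_
      convert h (Function.update a i b) using 4 with y
      funext j
      by_cases hj : j = i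
      · subst hj; simp
      · by_cases hjM : j ∈ M <;> simp [Finset.piecewise, hj, hjM]
    obtain ⟨t₀, h₀, d₀⟩ := key false
    obtain ⟨t₁, h₁, d₁⟩ := key true
    refine ⟨.query i t₀ t₁, fun x => ?_, ?_⟩
    · cases hx : x i
      · have : Function.update x i false = x := by rw [← hx, Function.update_eq_self]
        simp [DecisionTree.eval, hx, h₀ x, this]
      · have : Function.update x i true = x := by rw [← hx, Function.update_eq_self]
        simp [DecisionTree.eval, hx, h₁ x, this]
    · rw [Finset.card_insert_of_notMem hi]
      simp only [DecisionTree.depth]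
      omega

/-- The restriction ignores `M`, so its blocks stay sensitive after removing `M`; a sensitive change
inside `M` then supplies one more disjoint block. -/
theorem SensitiveBlocks.cons_of_restrict {n N : ℕ} {f : (Fin n → Bool) → Bool}
    {M : Finset (Fin n)} {a y : Fin n → Bool} {B : Fin N → Finset (Fin n)}
    (hM : ∀ x, ∃ y, (∀ j, j ∉ M → y j = x j) ∧ f y ≠ f x)
    (hB : SensitiveBlocks (fun y => f (M.piecewise a y)) y B) :
    ∃ B' : Fin (N + 1) → Finset (Fin n), SensitiveBlocks f (M.piecewise a y) B' := by
  classical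
  set x := M.piecewise a y with hx
  obtain ⟨w, hw, hfw⟩ := hM x
  refine ⟨Fin.cons (M.filter fun j => w j ≠ x j) fun i => B i \ M, ?_, ?_⟩
  · intro i j hij
    cases i using Fin.cases <;> cases j using Fin.cases
    · exact absurd rfl hij
    · simp only [Fin.cons_zero, Fin.cons_succ]
      exact Finset.disjoint_sdiff.mono_left (Finset.filter_subset _ _)
    · simp only [Fin.cons_zero, Fin.cons_succ]
      exact Finset.sdiff_disjoint.mono_right (Finset.filter_subset _ _)
    · simp only [Fin.cons_succ]
      exact (hB.1 fun h => hij (congrArg Fin.succ h)).mono Finset.sdiff_subset Finset.sdiff_subset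
  · intro i
    refine Fin.cases ?_ (fun i => ?_) i
    · have : flipOn x (M.filter fun j => w j ≠ x j) = w := by
        funext j
        by_cases hj : j ∈ M
        · cases h1 : w j <;> cases h2 : x j <;> simp [flipOn, hj, h1, h2]
        · simp [flipOn, hj, hw j hj]
      simpa [this] using hfw
    · have : flipOn x (B i \ M) = M.piecewise a (flipOn y (B i)) := by
        funext j
        by_cases hj : j ∈ M <;> simp [hx, flipOn, hj]
      simpa [this] using hB.2 i

theorem hasDepthLE_of_sensitiveBlocks_le {n d : ℕ} (k : ℕ) :
    ∀ f : (Fin n → Bool) → Bool, boolDegree f ≤ d →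
      (∀ (x : Fin n → Bool) (N : ℕ) (B : Fin N → Finset (Fin n)), SensitiveBlocks f x B → N ≤ k) →
      HasDepthLE f (d * k) := by
  classical
  induction k with
  | zero =>
    intro f hd hk
    by_cases hf : ∃ x y, f x ≠ f y
    · obtain ⟨x, y, hxy⟩ := hf
      have h : SensitiveBlocks f y (fun _ : Fin 1 => {j | x j ≠ y j}) := by
        refine ⟨fun i j hij => absurd (Subsingleton.elim i j) hij, fun _ => ?_⟩
        have : flipOn y {j | x j ≠ y j} = x := by
          funext j
          cases h1 : x j <;> cases h2 : y j <;> simp [flipOn, h1, h2]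
        rwa [this]
      exact absurd (hk _ _ _ h) (by simp)
    · push Not at hf
      exact ⟨.leaf (f fun _ => false), fun x => hf _ _, by simp [DecisionTree.depth]⟩
  | succ k ih =>
    intro f hd hk
    by_cases hf : ∃ x y, f x ≠ f y
    · obtain ⟨M, hMd, hM⟩ := exists_finset_sensitive f hf
      have := hasDepthLE_of_restrict (m := d * k) M f fun a => ih _
        ((boolDegree_comp_le f _ fun j => ?_).trans hd) fun y N B hB => ?_
      · obtain ⟨t, ht, hdep⟩ := this
        refine ⟨t, ht, hdep.trans ?_⟩
        rw [Nat.mul_succ]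
        omega
      · by_cases hj : j ∈ M
        · exact Or.inl ⟨a j, fun z => by simp [hj]⟩
        · exact Or.inr ⟨j, false, fun z => by simp [hj]⟩
      · obtain ⟨B', hB'⟩ := hB.cons_of_restrict hM
        exact Nat.succ_le_succ_iff.mp (hk _ _ _ hB')
    · push Not at hf
      exact ⟨.leaf (f fun _ => false), fun x => hf _ _, by simp [DecisionTree.depth]⟩

theorem HasDepthLE.dictator_or_const {n : ℕ} {f : (Fin n → Bool) → Bool} (h : HasDepthLE f 1) :
    HasDepthLE f 0 ∨ ∃ i, f = (fun x => x i) ∨ f = (fun x => !(x i)) := by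
  obtain ⟨t, ht, hd⟩ := h
  match t, ht, hd with
  | .leaf b, ht, _ => exact Or.inl ⟨.leaf b, ht, le_rfl⟩
  | .query i (.leaf a) (.leaf b), ht, _ =>
    have hx : ∀ x, f x = if x i then b else a := fun x => (ht x).symm
    cases a <;> cases b
    · exact Or.inl ⟨.leaf false, fun x => by simp [DecisionTree.eval, hx], le_rfl⟩
    · exact Or.inr ⟨i, Or.inl (funext fun x => by simp [hx])⟩
    · exact Or.inr ⟨i, Or.inr (funext fun x => by cases h : x i <;> simp [hx, h])⟩
    · exact Or.inl ⟨.leaf true, fun x => by simp [DecisionTree.eval, hx], le_rfl⟩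
  | .query _ (.query _ _ _) _, _, hd => simp [DecisionTree.depth] at hd
  | .query _ _ (.query _ _ _), _, hd => simp [DecisionTree.depth] at hd

/-! ### The constant and the conclusion -/

theorem mul_le_sq_of_mul_sub_one_le {d N : ℝ} (hd : 2 ≤ d)
    (h : N * (N - 1) ≤ 2 / 3 * (d ^ 2 * (d ^ 2 - 1))) : (Real.sqrt 10 - 2) * N ≤ d ^ 2 := by
  have hs : Real.sqrt 10 ≤ 3.163 := Real.sqrt_le_iff.mpr (by norm_num)
  have hs2 : 2 ≤ Real.sqrt 10 := Real.le_sqrt_of_sq_le (by norm_num)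
  have hd4 : 4 ≤ d ^ 2 := by nlinarith
  generalize d ^ 2 = u at *
  -- 1.163 is a rational just above √10-2; N > u/1.163 would contradict `h` as soon as u ≥ 4.
  have hN : 1.163 * N ≤ u := by
    by_contra! hcon
    nlinarith
  rcases le_total 0 N with h0 | h0 <;> nlinarith

theorem mainTheorem9 (n : ℕ) (f : (Fin n → Bool) → Bool)
    (hf : ∀ i : Fin n, f ≠ (fun x => x i) ∧ f ≠ (fun x => !(x i))) :
    (Real.sqrt 10 - 2) * (decisionTreeComplexity f : ℝ) ≤ (boolDegree f : ℝ) ^ 3 := by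
  have hs : 2 < Real.sqrt 10 := Real.lt_sqrt_of_sq_lt (by norm_num)
  rcases le_or_gt 2 (boolDegree f) with hd | hd
  · have hd' : (2 : ℝ) ≤ boolDegree f := by exact_mod_cast hd
    have hs0 : 0 < Real.sqrt 10 - 2 := by linarith
    set k := ⌊(boolDegree f : ℝ) ^ 2 / (Real.sqrt 10 - 2)⌋₊ with hk
    have hD := (hasDepthLE_of_sensitiveBlocks_le k f le_rfl fun x N B hB => by
      rw [hk, Nat.le_floor_iff (by positivity), le_div_iff₀ hs0, mul_comm]
      exact mul_le_sq_of_mul_sub_one_le hd' hB.mul_sub_one_le).complexity_le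
    have hD' : (decisionTreeComplexity f : ℝ) ≤ boolDegree f * k := by exact_mod_cast hD
    have hk' : (k : ℝ) * (Real.sqrt 10 - 2) ≤ (boolDegree f : ℝ) ^ 2 :=
      (le_div_iff₀ hs0).mp (Nat.floor_le (by positivity))
    calc (Real.sqrt 10 - 2) * (decisionTreeComplexity f : ℝ)
        ≤ (Real.sqrt 10 - 2) * (boolDegree f * k) := by gcongr
      _ = boolDegree f * (k * (Real.sqrt 10 - 2)) := by ring
      _ ≤ boolDegree f * (boolDegree f : ℝ) ^ 2 := by gcongr
      _ = _ := by ring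
  -- For d ≤ 1 the block bound reads N(N-1) ≤ 0, which excludes N ≥ 2.
  · have hD : HasDepthLE f 1 := by
      obtain ⟨t, ht, hdep⟩ := hasDepthLE_of_sensitiveBlocks_le 1 f
        (Nat.lt_succ_iff.mp hd) fun x N B hB => by
          have h := hB.mul_sub_one_le
          by_contra! hN
          have hN' : (2 : ℝ) ≤ N := by exact_mod_cast hN
          have h1 : (boolDegree f : ℝ) ≤ 1 := by exact_mod_cast Nat.lt_succ_iff.mp hd
          have h0 : (0 : ℝ) ≤ boolDegree f := by positivity
          have h2 : (boolDegree f : ℝ) ^ 2 * ((boolDegree f : ℝ) ^ 2 - 1) ≤ 0 :=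
            mul_nonpos_of_nonneg_of_nonpos (sq_nonneg _) (by nlinarith)
          nlinarith
      exact ⟨t, ht, hdep⟩
    rcases hD.dictator_or_const with h | ⟨i, h | h⟩
    · rw [Nat.le_zero.mp h.complexity_le]
      simp
    · exact absurd h (hf i).1
    · exact absurd h (hf i).2
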